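/- Let $\mathbb D$ be the set of càdlàg (right-continuous with left limits) functions $x:[0,1]\to\mathbb R$, with uniform norm $\|x\|=\sup_{s\in[0,1]}|x(s)|$ and Skorohod distance $$d_{J_1}^0(x,y)=\inf_{\lambda}\Big(\sup_{s<s'}\Big|\log\tfrac{\lambda(s')-\lambda(s)}{s'-s}\Big|\ \vee\ \|x-y\circ\lambda\|\Big),$$ the infimum being over all strictly increasing continuous maps $\lambda$ of $[0,1]$ onto $[0,1]$. Its topology is the $J_1$ topology, and $\mathbb D$ carries the corresponding Borel $\sigma$-field; random elements of $\mathbb D$ are measurable with respect to it. For $x\in\mathbb D$ and $\delta\in(0,1)$ let $$w'(x,\delta)=\inf_{\{t_i\}}\max_{1\le i\le v}\ \sup_{s_1,s_2\in[t_{i-1},t_i)}|x(s_1)-x(s_2)|,$$ the infimum being over all finite sets $0=t_0<t_1<\dots<t_v=1$ with $\min_i(t_i-t_{i-1})>\delta$. Let $\mathbb D([0,1];\mathbb D)$ be the set of functions $[0,1]\to\mathbb D$ that are right-continuous and have left limits (in $\mathbb D$) with respect to $J_1$. **Theorem.** Let $\{X(t)\}_{t\in[0,1]}$ be a collection of random elements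 of $\mathbb D$ defined on one probability space $(\Omega,\mathcal F,P)$ such that: (a) there exist $\alpha>1/2$, $\beta\ge 0$ and a non-decreasing continuous function $F:[0,1]\to\mathbb R$ such that for all $t_1\le t\le t_2$ in $[0,1]$ and all $\lambda>0$, $$P\big(\|X(t)-X(t_1)\|\wedge\|X(t_2)-X(t)\|\ge\lambda\big)\le\frac{1}{\lambda^{4\beta}}\,[F(t_2)-F(t_1)]^{2\alpha};$$ (b) for every $\varepsilon>0$, $$\lim_{\delta\to0^+}\limsup_{n\to\infty}P\big(w'(X(i/2^n),\delta)\ge\varepsilon\ \text{for some integer } 0\le i\le 2^n\big)=0;$$ (c) for every $t\in[0,1)$ and every non-increasing sequence $(t_n)_{n\ge1}$ in $[0,1]$ with $t_n\to t$, $d_{J_1}^0(X(t_n),X(t))\to0$ in probability. Then there exist a probability space $(\Omega',\mathcal F',P')$ and a collection $\{Y(t)\}_{t\in[0,1]}$ of random elements of $\mathbb D$ defined on it such that, for every $\omega'\in\Omega'$, the map $t\mapsto Y(\omega',t)$ belongs to $\mathbb D([0,1];\mathbb D)$, and, for all $k\ge1$ and $t_1,\dots,t_k\in[0,1]$, the vectors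 $(X(t_1),\dots,X(t_k))$ and $(Y(t_1),\dots,Y(t_k))$ have the same distribution in $\mathbb D^k$. -/

import Mathlib

open MeasureTheory Filter Topology Set
open scoped ENNReal unitInterval

noncomputable section

/-- A function on `[0,1]` with values in a topological space is càdlàg if it is right-continuous
at every point and has a left limit at every point (for `t = 0` the filter `𝓝[<] t` is trivial,
and for `t = 1` so is right-continuity). -/
def IsCadlag {E : Type*} [TopologicalSpace E] (x : I → E) : Prop :=
  ∀ t : I, ContinuousWithinAt x (Ici t) t ∧ ∃ l : E, Tendsto x (𝓝[<] t) (𝓝 l)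

/-- The set `𝔻` of real-valued càdlàg functions on `[0,1]`. -/
structure SkorohodD where
  toFun : I → ℝ
  isCadlag : IsCadlag toFun

namespace SkorohodD

instance : CoeFun SkorohodD (fun _ => I → ℝ) := ⟨SkorohodD.toFun⟩

/-- The supremum norm of a function on `[0,1]`, as an extended nonnegative number
(it is finite for càdlàg functions). -/
def supNorm (f : I → ℝ) : ℝ≥0∞ := ⨆ s : I, ‖f s‖ₑ

/-- `‖γ‖⁰ = sup_{s < s'} |log ((γ s' - γ s) / (s' - s))|` for an increasing bijection `γ` of
`[0,1]`; the order isomorphisms of `[0,1]` are exactly the strictly increasing continuous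
functions from `[0,1]` onto `[0,1]`. -/
def logSlope (γ : I ≃o I) : ℝ≥0∞ :=
  ⨆ (s : I) (s' : I) (_ : s < s'),
    ENNReal.ofReal |Real.log (((γ s' : ℝ) - (γ s : ℝ)) / ((s' : ℝ) - (s : ℝ)))|

/-- The Skorohod distance `d_{J₁}^0(x, y) = inf_γ (‖γ‖⁰ ∨ ‖x - y ∘ γ‖)`. -/
def distJ1 (x y : SkorohodD) : ℝ≥0∞ :=
  ⨅ γ : I ≃o I, max (logSlope γ) (supNorm fun s => x s - y (γ s))

lemma logSlope_refl : logSlope (OrderIso.refl I) = 0 := by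
  simp only [logSlope, ENNReal.iSup_eq_zero]
  intro s s' h
  have h' : (s' : ℝ) - (s : ℝ) ≠ 0 := sub_ne_zero.2 (ne_of_gt (by exact_mod_cast h))
  simp [div_self h']

lemma logSlope_symm_le (γ : I ≃o I) : logSlope γ.symm ≤ logSlope γ := by
  refine iSup_le fun s => iSup_le fun s' => iSup_le fun h => ?_
  refine le_trans (le_of_eq ?_)
    (le_iSup_of_le (γ.symm s) (le_iSup_of_le (γ.symm s') (le_iSup_of_le
      (γ.symm.lt_iff_lt.2 h) le_rfl)))
  rw [OrderIso.apply_symm_apply, OrderIso.apply_symm_apply, ← abs_neg, ← Real.log_inv, inv_div]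

lemma logSlope_trans_le (γ κ : I ≃o I) :
    logSlope (γ.trans κ) ≤ logSlope γ + logSlope κ := by
  refine iSup_le fun s => iSup_le fun s' => iSup_le fun h => ?_
  have hγ : γ s < γ s' := γ.lt_iff_lt.2 h
  have hκ : κ (γ s) < κ (γ s') := κ.lt_iff_lt.2 hγ
  have p1 : (0 : ℝ) < (s' : ℝ) - s := sub_pos.2 (by exact_mod_cast h)
  have p2 : (0 : ℝ) < (γ s' : ℝ) - γ s := sub_pos.2 (by exact_mod_cast hγ)
  have p3 : (0 : ℝ) < (κ (γ s') : ℝ) - κ (γ s) := sub_pos.2 (by exact_mod_cast hκ)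
  have e : ((κ (γ s') : ℝ) - κ (γ s)) / ((s' : ℝ) - s)
      = (((γ s' : ℝ) - γ s) / ((s' : ℝ) - s)) *
        (((κ (γ s') : ℝ) - κ (γ s)) / ((γ s' : ℝ) - γ s)) := by
    field_simp
  simp only [OrderIso.trans_apply]
  rw [e, Real.log_mul (div_pos p2 p1).ne' (div_pos p3 p2).ne']
  refine (ENNReal.ofReal_le_ofReal (abs_add_le _ _)).trans ?_
  rw [ENNReal.ofReal_add (abs_nonneg _) (abs_nonneg _)]
  exact add_le_add
    (le_iSup_of_le s (le_iSup_of_le s' (le_iSup_of_le h le_rfl)))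
    (le_iSup_of_le (γ s) (le_iSup_of_le (γ s') (le_iSup_of_le hγ le_rfl)))

lemma distJ1_self (x : SkorohodD) : distJ1 x x = 0 := by
  refine le_antisymm (iInf_le_of_le (OrderIso.refl I) ?_) zero_le
  simp [logSlope_refl, supNorm]

lemma distJ1_comm_le (x y : SkorohodD) : distJ1 x y ≤ distJ1 y x := by
  refine le_iInf fun γ => iInf_le_of_le γ.symm (max_le_max (logSlope_symm_le γ) ?_)
  refine iSup_le fun s => le_iSup_of_le (γ.symm s) ?_
  beta_reduce
  rw [OrderIso.apply_symm_apply, ← enorm_neg, neg_sub]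

lemma distJ1_triangle (x y z : SkorohodD) : distJ1 x z ≤ distJ1 x y + distJ1 y z := by
  unfold distJ1
  refine ENNReal.le_iInf_add_iInf fun γ κ => iInf_le_of_le (γ.trans κ) (max_le ?_ ?_)
  · exact (logSlope_trans_le γ κ).trans (add_le_add (le_max_left _ _) (le_max_left _ _))
  · refine iSup_le fun s => ?_
    have h : x s - z ((γ.trans κ) s) = (x s - y (γ s)) + (y (γ s) - z (κ (γ s))) := by
      simp [OrderIso.trans_apply]
    beta_reduce
    rw [h]
    refine (enorm_add_le _ _).trans (add_le_add ?_ ?_)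
    · exact le_max_of_le_right
        (le_iSup (fun s => ‖x s - y (γ s)‖ₑ) s)
    · exact le_max_of_le_right
        (le_iSup (fun s => ‖y s - z (κ s)‖ₑ) (γ s))

/-- `𝔻` with the distance `d_{J₁}^0`; its topology is the Skorohod `J₁` topology. -/
instance : PseudoEMetricSpace SkorohodD where
  edist := distJ1
  edist_self := distJ1_self
  edist_comm x y := le_antisymm (distJ1_comm_le x y) (distJ1_comm_le y x)
  edist_triangle := distJ1_triangle

/-- The Borel σ-field of the `J₁` topology. -/
instance : MeasurableSpace SkorohodD := borel SkorohodD

instance : BorelSpace SkorohodD := ⟨rfl⟩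

/-- `0 = t₀ < t₁ < ⋯ < t_v = 1` with all gaps greater than `δ` (here `δ > 0`). -/
def IsSparse (δ : ℝ) (v : ℕ) (t : Fin (v + 1) → I) : Prop :=
  t 0 = 0 ∧ t (Fin.last v) = 1 ∧ ∀ i : Fin v, δ < (t i.succ : ℝ) - (t i.castSucc : ℝ)

/-- The oscillation `w(x, T) = sup_{s₁, s₂ ∈ T} |x(s₁) - x(s₂)|`. -/
def osc (x : SkorohodD) (T : Set I) : ℝ≥0∞ :=
  ⨆ s₁ ∈ T, ⨆ s₂ ∈ T, ‖x s₁ - x s₂‖ₑ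

/-- The modulus `w'(x, δ) = inf_{t} max_i w(x, [t_{i-1}, t_i))`, the infimum being over all
`δ`-sparse sets, for `δ ∈ (0,1)`. -/
def modulus (x : SkorohodD) (δ : ℝ) : ℝ≥0∞ :=
  ⨅ (v : ℕ) (t : Fin (v + 1) → I) (_ : IsSparse δ v t),
    ⨆ i : Fin v, osc x (Ico (t i.castSucc) (t i.succ))

end SkorohodD

end

/-! Hypothesis (a) bounds uniform norms, and the càdlàg functions are complete for the uniform
distance, so limits of paths are taken there; the identity into `J₁` is 1-Lipschitz and carries them
over.

Take a dyadic grid on which `G = F + id` has equal increments. As `2α > 1`, Borel–Cantelli gives,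
almost surely and at every large level `m`, that each new midpoint is within `ρ ^ m` of one of its
two neighbours. Moving midpoints to such neighbours is a monotone map between grids
(`exists_dyadic_step`). Composing these maps approximates the path on the whole grid, up to a
geometric tail, by a function of a monotone integer index (`isRegulatedOn_of_dyadic`).

Such an index is constant just to the right and just to the left of any point, so one-sided limits
along the grid exist, and the right limits form a càdlàg path (`IsRegulatedOn.exists_isCadlag`). By
(c) these limits agree almost surely with `X t` at each fixed `t` (`exists_cadlag_modification`). -/

/-- A path `x` is regulated on `D` if, up to any positive error, its restriction to `D` is
determined by a monotone `ℕ`-valued function. -/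
def IsRegulatedOn {E : Type*} [PseudoEMetricSpace E] (D : Set I) (x : I → E) : Prop :=
  ∀ ε : ℝ≥0∞, 0 < ε → ∃ p : I → ℕ, MonotoneOn p D ∧
    ∀ s ∈ D, ∀ s' ∈ D, p s = p s' → edist (x s) (x s') ≤ ε

/-! ### Regulated paths: one-sided limits and càdlàg regularization. -/

section Regulated

variable {E : Type*} [PseudoEMetricSpace E] {D : Set I} {x : I → E}

lemma cauchy_map_of_edist_le {ι : Type*} {x : ι → E} {l : Filter ι} [NeBot l]
    (h : ∀ ε : ℝ≥0∞, 0 < ε → ∃ S ∈ l, ∀ s ∈ S, ∀ s' ∈ S, edist (x s) (x s') ≤ ε) :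
    Cauchy (map x l) := by
  refine EMetric.cauchy_iff.2 ⟨(inferInstance : NeBot (map x l)).ne, fun ε hε => ?_⟩
  obtain ⟨δ, hδ, hδε⟩ := exists_between hε
  obtain ⟨S, hS, h⟩ := h δ hδ
  refine ⟨x '' S, image_mem_map hS, ?_⟩
  rintro _ ⟨s, hs, rfl⟩ _ ⟨s', hs', rfl⟩
  exact (h s hs s' hs').trans_lt hδε

lemma neBot_nhdsGT_inf_principal (hD : Dense D) {t : I} (ht : t < 1) :
    NeBot (𝓝[>] t ⊓ 𝓟 D) := by
  refine inf_principal_neBot_iff.2 fun U hU => ?_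
  obtain ⟨u, hu, hU⟩ := (mem_nhdsGT_iff_exists_Ioo_subset' ht).1 hU
  obtain ⟨s, hs, h⟩ := hD.exists_between hu
  exact ⟨s, hU h, hs⟩

lemma neBot_nhdsLT_inf_principal (hD : Dense D) {t : I} (ht : 0 < t) :
    NeBot (𝓝[<] t ⊓ 𝓟 D) := by
  refine inf_principal_neBot_iff.2 fun U hU => ?_
  obtain ⟨u, hu, hU⟩ := (mem_nhdsLT_iff_exists_Ioo_subset' ht).1 hU
  obtain ⟨s, hs, h⟩ := hD.exists_between hu
  exact ⟨s, hU h, hs⟩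

/-- The index attains its minimum over `D ∩ (t, 1]` at some `s₀`; by monotonicity it is constant on
`D ∩ (t, s₀)`, so the path oscillates there by at most `ε`. -/
lemma IsRegulatedOn.exists_tendsto_right [CompleteSpace E] (hx : IsRegulatedOn D x)
    (hD : Dense D) {t : I} (ht : t < 1) : ∃ l, Tendsto x (𝓝[>] t ⊓ 𝓟 D) (𝓝 l) := by
  have := neBot_nhdsGT_inf_principal hD ht
  refine cauchy_map_iff_exists_tendsto.1 (cauchy_map_of_edist_le fun ε hε => ?_)
  obtain ⟨p, hp, hpx⟩ := hx ε hε
  obtain ⟨s₁, hs₁, hs₁t⟩ := hD.exists_between ht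
  have hne : (p '' (D ∩ Ioi t)).Nonempty := ⟨_, s₁, ⟨hs₁, hs₁t.1⟩, rfl⟩
  obtain ⟨s₀, ⟨hs₀, hts₀⟩, hps₀⟩ := Nat.sInf_mem hne
  have key : ∀ s ∈ D ∩ Ioo t s₀, p s = p s₀ := fun s hs =>
    le_antisymm (hp hs.1 hs₀ hs.2.2.le) (hps₀ ▸ Nat.sInf_le ⟨s, ⟨hs.1, hs.2.1⟩, rfl⟩)
  refine ⟨D ∩ Ioo t s₀, ?_, fun s hs s' hs' =>
    hpx s hs.1 s' hs'.1 ((key s hs).trans (key s' hs').symm)⟩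
  rw [inter_comm]
  exact inter_mem_inf (Ioo_mem_nhdsGT hts₀) (mem_principal_self D)

lemma IsRegulatedOn.exists_tendsto_left [CompleteSpace E] (hx : IsRegulatedOn D x)
    (hD : Dense D) (h1 : 1 ∈ D) {t : I} (ht : 0 < t) :
    ∃ l, Tendsto x (𝓝[<] t ⊓ 𝓟 D) (𝓝 l) := by
  have := neBot_nhdsLT_inf_principal hD ht
  refine cauchy_map_iff_exists_tendsto.1 (cauchy_map_of_edist_le fun ε hε => ?_)
  obtain ⟨p, hp, hpx⟩ := hx ε hε
  obtain ⟨s₁, hs₁, hs₁t⟩ := hD.exists_between ht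
  have hne : (p '' (D ∩ Iio t)).Nonempty := ⟨_, s₁, ⟨hs₁, hs₁t.2⟩, rfl⟩
  -- The maximum of the index replaces the minimum; `1 ∈ D` is what bounds it.
  have hbdd : BddAbove (p '' (D ∩ Iio t)) := by
    refine ⟨p 1, ?_⟩
    rintro _ ⟨s, hs, rfl⟩
    exact hp hs.1 h1 unitInterval.le_one'
  obtain ⟨s₀, ⟨hs₀, hts₀⟩, hps₀⟩ := Nat.sSup_mem hne hbdd
  have key : ∀ s ∈ D ∩ Ioo s₀ t, p s = p s₀ := fun s hs =>
    le_antisymm (hps₀ ▸ le_csSup hbdd ⟨s, ⟨hs.1, hs.2.2⟩, rfl⟩) (hp hs₀ hs.1 hs.2.1.le)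
  refine ⟨D ∩ Ioo s₀ t, ?_, fun s hs s' hs' =>
    hpx s hs.1 s' hs'.1 ((key s hs).trans (key s' hs').symm)⟩
  rw [inter_comm]
  exact inter_mem_inf (Ioo_mem_nhdsLT hts₀) (mem_principal_self D)

/-- A path regulated on a dense set `D` has a càdlàg modification, given by its right limits
along `D`. -/
lemma IsRegulatedOn.exists_isCadlag [CompleteSpace E] (hx : IsRegulatedOn D x)
    (hD : Dense D) (h1 : 1 ∈ D) :
    ∃ y : I → E, IsCadlag y ∧ y 1 = x 1 ∧ ∀ t < 1, Tendsto x (𝓝[>] t ⊓ 𝓟 D) (𝓝 (y t)) := by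
  classical
  choose l hl using fun t : I => fun ht : t < 1 => hx.exists_tendsto_right hD ht
  set y : I → E := fun t => if ht : t < 1 then l t ht else x 1 with hy
  have hyl : ∀ t < 1, Tendsto x (𝓝[>] t ⊓ 𝓟 D) (𝓝 (y t)) := fun t ht => by
    simpa only [hy, dif_pos ht] using hl t ht
  -- Closed-ball bounds on `D ∩ (a, b)` pass to right limits; this yields both right-continuity and
  -- left limits of `y`.
  have hclose : ∀ (a b : I) (c : E) (ε : ℝ≥0∞),
      (∀ s ∈ D ∩ Ioo a b, edist (x s) c ≤ ε) → ∀ u ∈ Ioo a b, edist (y u) c ≤ ε := by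
    intro a b c ε h u hu
    have hu1 : u < 1 := hu.2.trans_le unitInterval.le_one'
    have := neBot_nhdsGT_inf_principal hD hu1
    refine le_of_tendsto ((hyl u hu1).edist tendsto_const_nhds) ?_
    filter_upwards [inter_mem_inf (Ioo_mem_nhdsGT hu.2) (mem_principal_self D)] with s hs
    exact h s ⟨hs.2, hu.1.trans hs.1.1, hs.1.2⟩
  refine ⟨y, fun t => ⟨?_, ?_⟩, by simp [hy], hyl⟩
  · rcases eq_or_lt_of_le (unitInterval.le_one' (t := t)) with rfl | ht
    · have : Ici (1 : I) = {1} := by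
        ext s; exact ⟨fun h => le_antisymm unitInterval.le_one' h, fun h => h.ge⟩
      rw [this]
      exact continuousWithinAt_singleton
    · rw [← continuousWithinAt_Ioi_iff_Ici, ContinuousWithinAt,
        Metric.nhds_basis_closedEBall.tendsto_right_iff]
      intro ε hε
      have h := (hyl t ht) (Metric.closedEBall_mem_nhds (y t) hε)
      obtain ⟨b, hb, hbU⟩ := (mem_nhdsGT_iff_exists_Ioo_subset' ht).1
        (mem_inf_principal.1 h)
      filter_upwards [Ioo_mem_nhdsGT hb] with u hu
      exact hclose t b _ ε (fun s hs => hbU hs.2 hs.1) u hu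
  · rcases eq_or_lt_of_le (unitInterval.nonneg' (t := t)) with rfl | ht
    · have : Iio (0 : I) = ∅ := by
        ext s; simp
      exact ⟨y 0, by simp [this]⟩
    · obtain ⟨c, hc⟩ := hx.exists_tendsto_left hD h1 ht
      refine ⟨c, Metric.nhds_basis_closedEBall.tendsto_right_iff.2 fun ε hε => ?_⟩
      have h := hc (Metric.closedEBall_mem_nhds c hε)
      obtain ⟨a, ha, haU⟩ := (mem_nhdsLT_iff_exists_Ioo_subset' ht).1
        (mem_inf_principal.1 h)
      filter_upwards [Ioo_mem_nhdsLT ha] with u hu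
      exact hclose a t c ε (fun s hs => haU hs.2 hs.1) u hu

end Regulated

/-! ### Chaining along a dyadic grid. -/

section Chaining

variable {E : Type*} [PseudoEMetricSpace E] {d : ℕ → ℕ → I} {x : I → E} {r : ℕ → ℝ≥0∞}

/-- Iterating the one-level maps `g (n + k - 1), …, g n` of the dyadic grids. -/
def dyadicProj (g : ℕ → ℕ → ℕ) (n : ℕ) : ℕ → ℕ → ℕ
  | 0, i => i
  | k + 1, i => dyadicProj g n k (g (n + k) i)

lemma dyadicProj_monotone {g : ℕ → ℕ → ℕ} (hg : ∀ m, Monotone (g m)) (n k : ℕ) :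
    Monotone (dyadicProj g n k) := by
  induction k with
  | zero => exact fun _ _ h => h
  | succ k ih => exact fun _ _ h => ih (hg _ h)

/-- Makes the projection independent of the level at which a grid point is represented. -/
lemma dyadicProj_add {g : ℕ → ℕ → ℕ} (hg : ∀ m i, g m (2 * i) = i) (n k j i : ℕ) :
    dyadicProj g n (k + j) (2 ^ j * i) = dyadicProj g n k i := by
  induction j with
  | zero => simp
  | succ j ih =>
    rw [← add_assoc, pow_succ', mul_assoc]
    change dyadicProj g n (k + j) (g (n + (k + j)) _) = _
    rw [hg, ih]

lemma edist_dyadicProj_le {g : ℕ → ℕ → ℕ} (hgm : ∀ m, Monotone (g m))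
    (hg : ∀ m i, g m (2 * i) = i) {n : ℕ}
    (hx : ∀ m ≥ n, ∀ j ≤ 2 ^ (m + 1), edist (x (d (m + 1) j)) (x (d m (g m j))) ≤ r m)
    (k : ℕ) : ∀ i ≤ 2 ^ (n + k),
      edist (x (d (n + k) i)) (x (d n (dyadicProj g n k i))) ≤ ∑ j ∈ Finset.range k, r (j + n) := by
  induction k with
  | zero => intro i _; simp [dyadicProj]
  | succ k ih =>
    intro i hi
    have hi' : g (n + k) i ≤ 2 ^ (n + k) := by
      have := hgm (n + k) hi
      rwa [← add_assoc, pow_succ', hg] at this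
    rw [Finset.sum_range_succ, add_comm (Finset.sum _ _)]
    refine (edist_triangle _ (x (d (n + k) (g (n + k) i))) _).trans (add_le_add ?_ (ih _ hi'))
    rw [add_comm k n]
    exact hx (n + k) (Nat.le_add_right _ _) i hi

/-- If each midpoint of a dyadic interval of level `m` is eventually within `r m` of one of the two
endpoints, each point of level `m + 1` is moved monotonically to a point of level `m`. -/
lemma exists_dyadic_step (hd : ∀ m i, d (m + 1) (2 * i) = d m i) {n : ℕ}
    (hx : ∀ m ≥ n, ∀ i < 2 ^ m, min (edist (x (d (m + 1) (2 * i + 1))) (x (d m i)))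
      (edist (x (d m (i + 1))) (x (d (m + 1) (2 * i + 1)))) ≤ r m) :
    ∃ g : ℕ → ℕ → ℕ, (∀ m, Monotone (g m)) ∧ (∀ m i, g m (2 * i) = i) ∧
      ∀ m ≥ n, ∀ j ≤ 2 ^ (m + 1), edist (x (d (m + 1) j)) (x (d m (g m j))) ≤ r m := by
  classical
  -- Even indices are halved; an odd one goes to its left neighbour unless that is too far. Either
  -- choice lies between the images of the two adjacent even indices, whence monotonicity.
  let g : ℕ → ℕ → ℕ := fun m j => if j % 2 = 1 ∧
    ¬ edist (x (d (m + 1) j)) (x (d m (j / 2))) ≤ r m then j / 2 + 1 else j / 2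
  refine ⟨g, fun m => monotone_nat_of_le_succ fun j => ?_, fun m i => ?_, fun m hm j hj => ?_⟩
  · simp only [g]
    split_ifs <;> omega
  · simp [g]
  · rcases Nat.even_or_odd' j with ⟨i, rfl | rfl⟩
    · simp [g, hd]
    · have hi : i < 2 ^ m := by rw [pow_succ] at hj; omega
      have h2 : (2 * i + 1) / 2 = i := by omega
      by_cases h : edist (x (d (m + 1) (2 * i + 1))) (x (d m i)) ≤ r m
      · have hgj : g m (2 * i + 1) = i := by
          simp only [g, h2]
          exact if_neg fun h' => h'.2 h
        rwa [hgj]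
      · have h' := (min_le_iff.1 (hx m hm i hi)).resolve_left h
        rw [edist_comm] at h'
        have hgj : g m (2 * i + 1) = i + 1 := by
          simp only [g, h2]
          exact if_pos ⟨by omega, h⟩
        rwa [hgj]

lemma dyadic_add (hd : ∀ m i, d (m + 1) (2 * i) = d m i) (m j i : ℕ) :
    d (m + j) (2 ^ j * i) = d m i := by
  induction j with
  | zero => simp
  | succ j ih => rw [← add_assoc, pow_succ', mul_assoc, hd, ih]

lemma isRegulatedOn_of_dyadic (hd : ∀ m i, d (m + 1) (2 * i) = d m i)
    (hmono : ∀ m, ∀ i ≤ 2 ^ m, ∀ j ≤ 2 ^ m, d m i ≤ d m j → i ≤ j)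
    (hr : ∑' m, r m ≠ ∞)
    (hx : ∀ᶠ m in atTop, ∀ i < 2 ^ m, min (edist (x (d (m + 1) (2 * i + 1))) (x (d m i)))
      (edist (x (d m (i + 1))) (x (d (m + 1) (2 * i + 1)))) ≤ r m) :
    IsRegulatedOn {t | ∃ m, ∃ i ≤ 2 ^ m, d m i = t} x := by
  intro ε hε
  have htail := (ENNReal.tendsto_sum_nat_add r hr).eventually_le_const (ENNReal.half_pos hε.ne')
  obtain ⟨n, hn, hnx⟩ := (htail.and (eventually_forall_ge_atTop.2 hx)).exists
  obtain ⟨g, hgm, hg, hgx⟩ := exists_dyadic_step hd hnx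
  -- Every grid point has a representation at some level at least `n`, from which it can be
  -- projected down to level `n`.
  have hrep : ∀ t ∈ {t | ∃ m, ∃ i ≤ 2 ^ m, d m i = t}, ∃ q : ℕ × ℕ,
      q.2 ≤ 2 ^ (n + q.1) ∧ d (n + q.1) q.2 = t := by
    rintro t ⟨m, i, hi, rfl⟩
    refine ⟨(m, 2 ^ n * i), ?_, ?_⟩
    · rw [pow_add]; exact Nat.mul_le_mul_left _ hi
    · rw [add_comm]; exact dyadic_add hd m n i
  choose! q hq hqt using hrep
  refine ⟨fun t => dyadicProj g n (q t).1 (q t).2, fun s hs t ht hst => ?_,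
    fun s hs s' hs' h => ?_⟩
  · beta_reduce
    -- Both points are lifted to a common level, where `hmono` turns their order into the order of
    -- indices.
    rw [← dyadicProj_add hg n (q s).1 (q t).1, ← dyadicProj_add hg n (q t).1 (q s).1,
      add_comm (q t).1]
    refine dyadicProj_monotone hgm n _ (hmono (n + ((q s).1 + (q t).1)) _ ?_ _ ?_ ?_)
    · rw [← add_assoc, pow_add _ (n + _), mul_comm]; exact Nat.mul_le_mul_right _ (hq s hs)
    · rw [add_comm (q s).1, ← add_assoc, pow_add _ (n + _), mul_comm]
      exact Nat.mul_le_mul_right _ (hq t ht)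
    · rw [← add_assoc, dyadic_add hd, hqt s hs, add_right_comm, dyadic_add hd, hqt t ht]
      exact hst
  · have key : ∀ t ∈ {t | ∃ m, ∃ i ≤ 2 ^ m, d m i = t},
        edist (x t) (x (d n (dyadicProj g n (q t).1 (q t).2))) ≤ ε / 2 := fun t ht => by
      have := edist_dyadicProj_le (r := r) hgm hg hgx (q t).1 (q t).2 (hq t ht)
      rw [hqt t ht] at this
      exact this.trans ((ENNReal.sum_le_tsum _).trans hn)
    calc edist (x s) (x s') ≤ _ := edist_triangle_right _ _ (x (d n (dyadicProj g n (q s).1 (q s).2)))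
      _ ≤ ε / 2 + ε / 2 := add_le_add (key s hs) (by simpa only [h] using key s' hs')
      _ = ε := ENNReal.add_halves ε

end Chaining

/-! ### Borel–Cantelli for the midpoint increments. -/

section Probability

/-- A continuous strictly increasing `G` on `[0,1]` yields a dyadic grid on whose intervals `G` has
equal increments. -/
lemma exists_dyadic_grid {G : I → ℝ} (hG : StrictMono G) (hGc : Continuous G) :
    ∃ d : ℕ → ℕ → I, (∀ m i, d (m + 1) (2 * i) = d m i) ∧
      (∀ m, ∀ i ≤ 2 ^ m, G (d m i) = G 0 + (G 1 - G 0) * (i / 2 ^ m)) ∧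
      (∀ m, ∀ i ≤ 2 ^ m, ∀ j ≤ 2 ^ m, d m i ≤ d m j → i ≤ j) ∧
      1 ∈ {t | ∃ m, ∃ i ≤ 2 ^ m, d m i = t} ∧ Dense {t | ∃ m, ∃ i ≤ 2 ^ m, d m i = t} := by
  have hC : 0 < G 1 - G 0 := sub_pos.2 (hG zero_lt_one)
  -- Truncating at `1` keeps the refinement identity valid for all indices.
  have hex : ∀ m i : ℕ, ∃ t, G t = G 0 + (G 1 - G 0) * min ((i : ℝ) / 2 ^ m) 1 := by
    intro m i
    refine mem_range_of_exists_le_of_exists_ge hGc ⟨0, ?_⟩ ⟨1, ?_⟩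
    · have : 0 ≤ min ((i : ℝ) / 2 ^ m) 1 := le_min (by positivity) zero_le_one
      nlinarith
    · have : min ((i : ℝ) / 2 ^ m) 1 ≤ 1 := min_le_right _ _
      nlinarith
  choose d hd using hex
  have hd' : ∀ m, ∀ i ≤ 2 ^ m, G (d m i) = G 0 + (G 1 - G 0) * (i / 2 ^ m) := by
    intro m i hi
    rw [hd, min_eq_left]
    rw [div_le_one (by positivity)]
    exact_mod_cast hi
  refine ⟨d, fun m i => hG.injective ?_, hd', fun m i hi j hj h => ?_, ⟨0, 1, by simp, ?_⟩, ?_⟩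
  · rw [hd, hd, pow_succ']
    push_cast
    rw [mul_div_mul_left _ _ two_ne_zero]
  · have h := hG.monotone h
    rw [hd' m i hi, hd' m j hj] at h
    have h := le_of_mul_le_mul_left (le_of_add_le_add_left h) hC
    rw [div_le_div_iff_of_pos_right (by positivity)] at h
    exact_mod_cast h
  · exact hG.injective (by rw [hd' 0 1 (by simp)]; simp)
  · refine dense_of_exists_between fun {s t} hst => ?_
    have hlt : (G s - G 0) / (G 1 - G 0) < (G t - G 0) / (G 1 - G 0) := by
      rw [div_lt_div_iff_of_pos_right hC]; linarith [hG hst]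
    obtain ⟨m, hm⟩ := exists_pow_lt_of_lt_one (sub_pos.2 hlt) (one_half_lt_one (α := ℝ))
    rw [div_pow, one_pow] at hm
    have hs0 : 0 ≤ (G s - G 0) / (G 1 - G 0) :=
      div_nonneg (sub_nonneg.2 (hG.monotone unitInterval.nonneg')) hC.le
    have ht1 : (G t - G 0) / (G 1 - G 0) ≤ 1 :=
      (div_le_one hC).2 (by linarith [hG.monotone (unitInterval.le_one' (t := t))])
    set a := (G s - G 0) / (G 1 - G 0)
    set b := (G t - G 0) / (G 1 - G 0) with hb
    have h2 : (0 : ℝ) < 2 ^ m := by positivity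
    have hai : a < (⌊a * 2 ^ m⌋₊ + 1 : ℕ) / 2 ^ m := by
      rw [lt_div_iff₀ h2]; exact_mod_cast Nat.lt_floor_add_one _
    have hib : ((⌊a * 2 ^ m⌋₊ + 1 : ℕ) : ℝ) / 2 ^ m < b := by
      have h3 : (⌊a * 2 ^ m⌋₊ : ℝ) ≤ a * 2 ^ m := Nat.floor_le (by positivity)
      have h4 : (⌊a * 2 ^ m⌋₊ : ℝ) / 2 ^ m ≤ a := (div_le_iff₀ h2).2 h3
      push_cast
      rw [add_div]
      linarith
    have hi : ⌊a * 2 ^ m⌋₊ + 1 ≤ 2 ^ m := by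
      have := (div_le_one h2).1 (hib.le.trans ht1)
      exact_mod_cast this
    have es : G s = G 0 + (G 1 - G 0) * a := by simp only [a]; field_simp; ring
    have et : G t = G 0 + (G 1 - G 0) * b := by simp only [b]; field_simp; ring
    refine ⟨_, ⟨m, _, hi, rfl⟩, ?_, ?_⟩
    · rw [← hG.lt_iff_lt, hd' m _ hi, es]; gcongr
    · rw [← hG.lt_iff_lt, hd' m _ hi, et]; gcongr

/-- There is a geometric sequence of thresholds for which the dyadic chaining bounds are a
geometric series. -/
lemma exists_chaining_rate {α β : ℝ} (hα : 1 / 2 < α) (hβ : 0 ≤ β) {C : ℝ} (hC : 0 ≤ C) :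
    ∃ ρ : ℝ, 0 < ρ ∧ ρ < 1 ∧ ∃ q : ℝ, 0 < q ∧ q < 1 ∧ ∀ m : ℕ,
      2 ^ m * (1 / (ρ ^ m) ^ (4 * β) * (C / 2 ^ m) ^ (2 * α)) = C ^ (2 * α) * q ^ m := by
  -- With `ρ = 2 ^ (-θ)` the common ratio is `2 ^ (1 + 4βθ - 2α)`, so `0 < θ` and `4βθ < 2α - 1` are
  -- needed; the `+ 1` covers `β = 0`.
  have hθ : 0 < (2 * α - 1) / (4 * β + 1) := div_pos (by linarith) (by linarith)
  have hθ' : (2 * α - 1) / (4 * β + 1) * (4 * β) < 2 * α - 1 := by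
    rw [div_mul_eq_mul_div, div_lt_iff₀ (by linarith)]
    nlinarith
  set θ := (2 * α - 1) / (4 * β + 1)
  refine ⟨2 ^ (-θ), by positivity, Real.rpow_lt_one_of_one_lt_of_neg one_lt_two (by linarith),
    2 ^ (1 + θ * (4 * β) - 2 * α), by positivity,
    Real.rpow_lt_one_of_one_lt_of_neg one_lt_two (by linarith), fun m => ?_⟩
  have h2 : (0 : ℝ) < 2 := two_pos
  rw [Real.div_rpow hC (by positivity), ← Real.rpow_natCast 2 m, ← Real.rpow_natCast (2 ^ (-θ)) m,
    ← Real.rpow_mul h2.le, ← Real.rpow_mul h2.le, ← Real.rpow_mul h2.le,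
    ← Real.rpow_natCast (2 ^ (1 + θ * (4 * β) - 2 * α)) m, ← Real.rpow_mul h2.le,
    one_div, ← Real.rpow_neg h2.le, div_eq_mul_inv, ← Real.rpow_neg h2.le,
    mul_left_comm (2 ^ (-(-θ * m * (4 * β)))), mul_left_comm, ← Real.rpow_add h2,
    ← Real.rpow_add h2]
  congr 2
  ring

/-- Under the moment-type bound on two consecutive increments, almost every path is regulated on a
fixed dense set. -/
lemma exists_dense_ae_isRegulatedOn {Ω E : Type*} [MeasurableSpace Ω] {P : Measure Ω}
    [PseudoEMetricSpace E] {x : I → Ω → E} {α β : ℝ} (hα : 1 / 2 < α) (hβ : 0 ≤ β)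
    {F : I → ℝ} (hFmono : Monotone F) (hFcont : Continuous F)
    (ha : ∀ t₁ t t₂ : I, t₁ ≤ t → t ≤ t₂ → ∀ r : ℝ, 0 < r →
      P {ω | ENNReal.ofReal r ≤ min (edist (x t ω) (x t₁ ω)) (edist (x t₂ ω) (x t ω))} ≤
        ENNReal.ofReal (1 / r ^ (4 * β) * (F t₂ - F t₁) ^ (2 * α))) :
    ∃ D : Set I, Dense D ∧ 1 ∈ D ∧ ∀ᵐ ω ∂P, IsRegulatedOn D fun t => x t ω := by
  -- Adding the identity makes `G` strictly increasing, so its grid is dense, while increments of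
  -- `F` stay below those of `G`.
  set G : I → ℝ := fun t => F t + t with hGdef
  have hG : StrictMono G := fun s t h => add_lt_add_of_le_of_lt (hFmono h.le) h
  have hGc : Continuous G := hFcont.add continuous_subtype_val
  obtain ⟨d, hd, hGd, hmono, h1, hD⟩ := exists_dyadic_grid hG hGc
  have hC : 0 < G 1 - G 0 := sub_pos.2 (hG zero_lt_one)
  obtain ⟨ρ, hρ, hρ1, q, hq, hq1, hρq⟩ := exists_chaining_rate hα hβ hC.le
  refine ⟨_, hD, h1, ?_⟩
  let B : ℕ → ℕ → Set Ω := fun m i => {ω | ENNReal.ofReal (ρ ^ m) ≤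
    min (edist (x (d (m + 1) (2 * i + 1)) ω) (x (d m i) ω))
      (edist (x (d m (i + 1)) ω) (x (d (m + 1) (2 * i + 1)) ω))}
  have hB : ∀ m, ∀ i < 2 ^ m, P (B m i) ≤
      ENNReal.ofReal (1 / (ρ ^ m) ^ (4 * β) * ((G 1 - G 0) / 2 ^ m) ^ (2 * α)) := by
    intro m i hi
    have hle : ∀ j k, j ≤ 2 ^ (m + 1) → k ≤ 2 ^ (m + 1) → j ≤ k →
        d (m + 1) j ≤ d (m + 1) k := by
      intro j k hj hk hjk
      by_contra! h
      obtain rfl : j = k := le_antisymm hjk (hmono _ _ hk _ hj h.le)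
      exact h.ne rfl
    have hp : 2 ^ (m + 1) = 2 * 2 ^ m := pow_succ' 2 m
    have hl : d m i ≤ d (m + 1) (2 * i + 1) := by
      rw [← hd m i]; exact hle _ _ (by omega) (by omega) (by omega)
    have hr : d (m + 1) (2 * i + 1) ≤ d m (i + 1) := by
      rw [← hd m (i + 1)]; exact hle _ _ (by omega) (by omega) (by omega)
    refine (ha _ _ _ hl hr (ρ ^ m) (by positivity)).trans (ENNReal.ofReal_le_ofReal ?_)
    have hinc : F (d m (i + 1)) - F (d m i) ≤ (G 1 - G 0) / 2 ^ m := by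
      have e1 := hGd m i hi.le
      have e2 := hGd m (i + 1) hi
      have h3 : (d m i : ℝ) ≤ d m (i + 1) := hl.trans hr
      have e3 : (G 1 - G 0) * (((i + 1 : ℕ) : ℝ) / 2 ^ m) - (G 1 - G 0) * (i / 2 ^ m)
          = (G 1 - G 0) / 2 ^ m := by push_cast; ring
      rw [hGdef] at e1 e2 e3 ⊢
      beta_reduce at e1 e2 e3 ⊢
      linarith
    have h0 : 0 ≤ F (d m (i + 1)) - F (d m i) := sub_nonneg.2 (hFmono (hl.trans hr))
    gcongr
  have hA : ∀ m, P (⋃ i ∈ Finset.range (2 ^ m), B m i) ≤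
      ENNReal.ofReal ((G 1 - G 0) ^ (2 * α)) * ENNReal.ofReal q ^ m := by
    intro m
    refine (measure_biUnion_finset_le _ _).trans
      ((Finset.sum_le_sum fun i hi => hB m i (Finset.mem_range.1 hi)).trans (le_of_eq ?_))
    rw [Finset.sum_const, Finset.card_range, nsmul_eq_mul, ← ENNReal.ofReal_pow hq.le,
      ← ENNReal.ofReal_mul (by positivity), ← hρq m,
      ENNReal.ofReal_mul (p := 2 ^ m) (by positivity)]
    congr 1
    rw [ENNReal.ofReal_pow two_pos.le]
    simp
  have hgeom : ∀ {a : ℝ}, a < 1 → ∑' m : ℕ, ENNReal.ofReal a ^ m ≠ ∞ := by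
    intro a ha
    rw [ENNReal.tsum_geometric]
    exact ENNReal.inv_ne_top.2 (tsub_pos_of_lt (ENNReal.ofReal_lt_one.2 ha)).ne'
  have hsum : ∑' m, P (⋃ i ∈ Finset.range (2 ^ m), B m i) ≠ ∞ := by
    refine ne_top_of_le_ne_top ?_ (ENNReal.tsum_le_tsum hA)
    rw [ENNReal.tsum_mul_left]
    exact ENNReal.mul_ne_top ENNReal.ofReal_ne_top (hgeom hq1)
  filter_upwards [ae_eventually_notMem hsum] with ω hω
  refine isRegulatedOn_of_dyadic (r := fun m => ENNReal.ofReal ρ ^ m) hd hmono (hgeom hρ1) ?_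
  filter_upwards [hω] with m hm i hi
  rw [← ENNReal.ofReal_pow hρ.le]
  by_contra! h
  exact hm (mem_biUnion (Finset.mem_coe.2 (Finset.mem_range.2 hi)) h.le)

end Probability

/-! ### Completeness of the càdlàg functions under the uniform distance. -/

section UniformCadlag

open scoped UniformConvergence

/-- Uniform limits of càdlàg functions are càdlàg. -/
lemma isClosed_isCadlag {E : Type*} [PseudoEMetricSpace E] [CompleteSpace E] :
    IsClosed {f : I →ᵤ E | IsCadlag (UniformFun.toFun f)} := by
  have hosc : ∀ (f : I →ᵤ E) (l : Filter I), f ∈ closure {f : I →ᵤ E |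
      NeBot l → ∃ c, Tendsto (UniformFun.toFun f) l (𝓝 c)} → NeBot l →
      ∃ c, Tendsto (UniformFun.toFun f) l (𝓝 c) := by
    intro f l hf hl
    refine cauchy_map_iff_exists_tendsto.1 (cauchy_map_of_edist_le fun ε hε => ?_)
    have hε3 : 0 < ε / 3 := ENNReal.div_pos hε.ne' (by simp)
    obtain ⟨g, hg, hfg⟩ := EMetric.mem_closure_iff.1 hf _ hε3
    obtain ⟨S, hS, hgS⟩ := (EMetric.cauchy_iff.1 (hg hl).choose_spec.cauchy_map).2 _ hε3
    refine ⟨_, hS, fun s hs s' hs' => ?_⟩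
    have hle : ∀ u, edist (UniformFun.toFun f u) (UniformFun.toFun g u) ≤ ε / 3 :=
      fun u => UniformFun.edist_eval_le.trans hfg.le
    calc edist (UniformFun.toFun f s) (UniformFun.toFun f s')
        ≤ edist (UniformFun.toFun f s) (UniformFun.toFun g s)
          + edist (UniformFun.toFun g s) (UniformFun.toFun g s')
          + edist (UniformFun.toFun g s') (UniformFun.toFun f s') := edist_triangle4 _ _ _ _
      _ ≤ ε / 3 + ε / 3 + ε / 3 := by
          refine add_le_add (add_le_add (hle s) (hgS _ hs _ hs').le) ?_
          rw [edist_comm]; exact hle s'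
      _ = ε := ENNReal.add_thirds ε
  refine isClosed_of_closure_subset fun f hf t => ⟨?_, ?_⟩
  · refine continuousWithinAt_of_locally_uniform_approx_of_continuousWithinAt self_mem_Ici
      fun u hu => ?_
    obtain ⟨ε, hε, hεu⟩ := mem_uniformity_edist.1 hu
    obtain ⟨g, hg, hfg⟩ := EMetric.mem_closure_iff.1 hf ε hε
    exact ⟨univ, univ_mem, UniformFun.toFun g, (hg t).1,
      fun y _ => hεu (UniformFun.edist_eval_le.trans_lt hfg)⟩
  · rcases (𝓝[<] t).eq_or_neBot with h | h
    · exact ⟨UniformFun.toFun f t, by simp [h]⟩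
    · exact hosc f _ (closure_mono (fun g hg _ => (hg t).2) hf) h

/-- The càdlàg functions on `[0,1]` with the uniform distance. -/
abbrev UniformCadlag := {f : I →ᵤ ℝ // IsCadlag (UniformFun.toFun f)}

instance : CompleteSpace UniformCadlag :=
  isClosed_isCadlag.completeSpace_coe

namespace SkorohodD

def toUniform (x : SkorohodD) : UniformCadlag := ⟨UniformFun.ofFun x, x.isCadlag⟩

def ofUniform (f : UniformCadlag) : SkorohodD := ⟨UniformFun.toFun f.1, f.2⟩

lemma edist_toUniform (x y : SkorohodD) :
    edist x.toUniform y.toUniform = supNorm fun s => x s - y s := by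
  rw [Subtype.edist_eq, UniformFun.edist_def]
  simp only [edist_eq_enorm_sub]
  rfl

lemma continuous_ofUniform : Continuous ofUniform := by
  refine (LipschitzWith.of_edist_le fun f g => ?_).continuous
  change distJ1 _ _ ≤ edist (ofUniform f).toUniform (ofUniform g).toUniform
  refine iInf_le_of_le (OrderIso.refl I) ?_
  rw [logSlope_refl, edist_toUniform]
  exact max_le zero_le le_rfl

end SkorohodD

end UniformCadlag

/-! ### Càdlàg modification and transfer to path space. -/

/-- The `𝔻`-valued càdlàg paths. -/
abbrev CadlagPath := {y : I → SkorohodD // IsCadlag y}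

/-- Measurable sets of the product σ-field do not separate inseparable families. -/
lemma mem_measurableSet_pi_iff_of_inseparable {ι E : Type*} [TopologicalSpace E]
    [MeasurableSpace E] [BorelSpace E] {A : Set (ι → E)} (hA : MeasurableSet A)
    {f g : ι → E} (hfg : ∀ i, Inseparable (f i) (g i)) : f ∈ A ↔ g ∈ A := by
  -- The sets that do not separate inseparable families form a σ-field, and it contains the
  -- cylinders.
  let m : MeasurableSpace (ι → E) :=
    { MeasurableSet' := fun A => ∀ f g : ι → E, (∀ i, Inseparable (f i) (g i)) → (f ∈ A ↔ g ∈ A)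
      measurableSet_empty := fun _ _ _ => Iff.rfl
      measurableSet_compl := fun A h f g hfg => not_congr (h f g hfg)
      measurableSet_iUnion := fun A h f g hfg => by
        simp only [mem_iUnion]
        exact exists_congr fun i => h i f g hfg }
  have hle : MeasurableSpace.pi ≤ m := by
    refine iSup_le fun i => ?_
    rintro _ ⟨B, hB, rfl⟩ f g hfg
    exact (hfg i).mem_measurableSet_iff hB
  exact hle A hA f g hfg

lemma map_eq_map_of_ae_inseparable {Ω ι E : Type*} [MeasurableSpace Ω] {P : Measure Ω}
    [TopologicalSpace E] [MeasurableSpace E] [BorelSpace E] [Countable ι] {X Y : ι → Ω → E}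
    (hX : ∀ i, Measurable (X i)) (hY : ∀ i, Measurable (Y i))
    (h : ∀ i, ∀ᵐ ω ∂P, Inseparable (X i ω) (Y i ω)) :
    P.map (fun ω i => X i ω) = P.map (fun ω i => Y i ω) := by
  ext A hA
  rw [Measure.map_apply (measurable_pi_lambda _ hX) hA,
    Measure.map_apply (measurable_pi_lambda _ hY) hA]
  refine measure_congr ?_
  filter_upwards [ae_all_iff.2 h] with ω hω
  exact propext (mem_measurableSet_pi_iff_of_inseparable hA hω)

/-- A `𝔻`-valued process satisfying the increment bound and right-continuous in probability has a
modification, up to topological indistinguishability, with càdlàg paths. -/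
lemma exists_cadlag_modification {Ω : Type*} [MeasurableSpace Ω] {P : Measure Ω}
    {X : I → Ω → SkorohodD} (hX : ∀ t, Measurable (X t))
    {α β : ℝ} (hα : 1 / 2 < α) (hβ : 0 ≤ β)
    {F : I → ℝ} (hFmono : Monotone F) (hFcont : Continuous F)
    (ha : ∀ t₁ t t₂ : I, t₁ ≤ t → t ≤ t₂ → ∀ r : ℝ, 0 < r →
      P {ω | ENNReal.ofReal r ≤
          min (SkorohodD.supNorm fun s => X t ω s - X t₁ ω s)
            (SkorohodD.supNorm fun s => X t₂ ω s - X t ω s)} ≤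
        ENNReal.ofReal (1 / r ^ (4 * β) * (F t₂ - F t₁) ^ (2 * α)))
    (hc : ∀ t : I, t < 1 → ∀ u : ℕ → I, Antitone u → Tendsto u atTop (𝓝 t) →
      TendstoInMeasure P (fun n => X (u n)) atTop (X t)) :
    ∃ Y : I → Ω → SkorohodD, (∀ t, Measurable (Y t)) ∧ (∀ ω, IsCadlag fun t => Y t ω) ∧
      ∀ t, ∀ᵐ ω ∂P, Inseparable (X t ω) (Y t ω) := by
  classical
  obtain ⟨D, hD, h1, hreg⟩ := exists_dense_ae_isRegulatedOn (x := fun t ω => (X t ω).toUniform)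
    hα hβ hFmono hFcont (by simpa only [SkorohodD.edist_toUniform] using ha)
  set N := toMeasurable P {ω | ¬ IsRegulatedOn D fun t => (X t ω).toUniform} with hN
  have hN0 : P N = 0 := by rw [hN, measure_toMeasurable]; exact hreg
  have hNm : MeasurableSet N := measurableSet_toMeasurable _ _
  have hNreg : ∀ ω, ω ∉ N → IsRegulatedOn D fun t => (X t ω).toUniform := fun ω hω => by
    by_contra h
    exact hω (subset_toMeasurable _ _ h)
  have hNae : ∀ᵐ ω ∂P, ω ∉ N := measure_eq_zero_iff_ae_notMem.1 hN0
  let c : SkorohodD := ⟨fun _ => 0, fun t => ⟨continuousWithinAt_const, 0, tendsto_const_nhds⟩⟩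
  have : Nonempty UniformCadlag := ⟨c.toUniform⟩
  choose! y hycad hy1 hylim using fun ω (hω : ω ∉ N) => (hNreg ω hω).exists_isCadlag hD h1
  let Y : I → Ω → SkorohodD := fun t => N.piecewise (fun _ => c) fun ω => .ofUniform (y ω t)
  have hYin : ∀ t, ∀ ω ∈ N, Y t ω = c := fun t ω hω => piecewise_eq_of_mem _ _ _ hω
  have hYout : ∀ t, ∀ ω ∉ N, Y t ω = .ofUniform (y ω t) :=
    fun t ω hω => piecewise_eq_of_notMem _ _ _ hω
  have hY1 : ∀ ω ∉ N, Y 1 ω = X 1 ω := fun ω hω => by rw [hYout 1 ω hω, hy1 ω hω]; rfl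
  -- One decreasing sequence in `D` serves twice: it makes `Y t` a `J₁`-limit of measurable maps,
  -- and it is admissible in (c).
  have hseq : ∀ t : I, t < 1 → ∃ u : ℕ → I, Antitone u ∧ Tendsto u atTop (𝓝 t) ∧
      ∀ ω ∉ N, Tendsto (fun n => X (u n) ω) atTop (𝓝 (Y t ω)) := by
    intro t ht
    obtain ⟨u, hu, huD, hut⟩ := hD.exists_seq_strictAnti_tendsto_of_lt ht
    refine ⟨u, hu.antitone, hut, fun ω hω => ?_⟩
    rw [hYout t ω hω]
    have hu' : Tendsto u atTop (𝓝[>] t ⊓ 𝓟 D) :=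
      tendsto_inf.2 ⟨tendsto_nhdsWithin_iff.2 ⟨hut, .of_forall fun n => (huD n).1.1⟩,
        tendsto_principal.2 (.of_forall fun n => (huD n).2)⟩
    exact (SkorohodD.continuous_ofUniform.tendsto _).comp ((hylim ω hω t ht).comp hu')
  refine ⟨Y, fun t => ?_, fun ω => ?_, fun t => ?_⟩
  · rcases eq_or_lt_of_le (unitInterval.le_one' (t := t)) with rfl | ht
    · have : Y 1 = N.piecewise (fun _ => c) (X 1) := by
        funext ω
        by_cases hω : ω ∈ N
        · rw [hYin 1 ω hω, piecewise_eq_of_mem _ _ _ hω]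
        · rw [hY1 ω hω, piecewise_eq_of_notMem _ _ _ hω]
      rw [this]
      exact measurable_const.piecewise hNm (hX 1)
    · obtain ⟨u, -, -, hu⟩ := hseq t ht
      refine measurable_of_tendsto_metrizable
        (f := fun n => N.piecewise (fun _ => c) (X (u n)))
        (fun n => measurable_const.piecewise hNm (hX _)) (tendsto_pi_nhds.2 fun ω => ?_)
      by_cases hω : ω ∈ N
      · simp only [hYin t ω hω, piecewise_eq_of_mem _ _ _ hω]
        exact tendsto_const_nhds
      · simp only [piecewise_eq_of_notMem _ _ _ hω]
        exact hu ω hω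
  · by_cases hω : ω ∈ N
    · simp only [hYin _ ω hω]
      exact fun t => ⟨continuousWithinAt_const, c, tendsto_const_nhds⟩
    · simp only [hYout _ ω hω]
      intro t
      obtain ⟨hr, l, hl⟩ := hycad ω hω t
      exact ⟨SkorohodD.continuous_ofUniform.continuousAt.comp_continuousWithinAt hr, _,
        (SkorohodD.continuous_ofUniform.tendsto l).comp hl⟩
  · rcases eq_or_lt_of_le (unitInterval.le_one' (t := t)) with rfl | ht
    · filter_upwards [hNae] with ω hω
      rw [hY1 ω hω]
    · obtain ⟨u, huanti, hut, hu⟩ := hseq t ht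
      obtain ⟨ns, hns, hlim⟩ := (hc t ht u huanti hut).exists_seq_tendsto_ae
      filter_upwards [hNae, hlim] with ω hω hω'
      -- Along an almost surely convergent subsequence, `X t` and `Y t` are limits of the same
      -- sequence for a pseudometric.
      exact tendsto_nhds_unique_inseparable hω' ((hu ω hω).comp hns.tendsto_atTop)


theorem mainTheorem12 {Ω : Type*} [MeasurableSpace Ω] (P : Measure Ω) [IsProbabilityMeasure P]
    (X : I → Ω → SkorohodD) (hX : ∀ t, Measurable (X t))
    (α β : ℝ) (hα : 1 / 2 < α) (hβ : 0 ≤ β)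
    (F : I → ℝ) (hFmono : Monotone F) (hFcont : Continuous F)
    (ha : ∀ t₁ t t₂ : I, t₁ ≤ t → t ≤ t₂ → ∀ r : ℝ, 0 < r →
      P {ω | ENNReal.ofReal r ≤
          min (SkorohodD.supNorm fun s => X t ω s - X t₁ ω s)
            (SkorohodD.supNorm fun s => X t₂ ω s - X t ω s)} ≤
        ENNReal.ofReal (1 / r ^ (4 * β) * (F t₂ - F t₁) ^ (2 * α)))
    (hb : ∀ ε : ℝ, 0 < ε →
      Tendsto (fun δ : ℝ => limsup (fun n : ℕ =>
          P {ω | ∃ t : I, (∃ i : ℕ, i ≤ 2 ^ n ∧ (t : ℝ) = (i : ℝ) / 2 ^ n) ∧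
            ENNReal.ofReal ε ≤ SkorohodD.modulus (X t ω) δ}) atTop)
        (𝓝[>] 0) (𝓝 0))
    (hc : ∀ t : I, t < 1 → ∀ u : ℕ → I, Antitone u → Tendsto u atTop (𝓝 t) →
      TendstoInMeasure P (fun n => X (u n)) atTop (X t)) :
    ∃ (Ω' : Type) (_ : MeasurableSpace Ω') (P' : Measure Ω') (_ : IsProbabilityMeasure P')
      (Y : I → Ω' → SkorohodD),
      (∀ t, Measurable (Y t)) ∧
      (∀ ω', IsCadlag fun t => Y t ω') ∧
      ∀ (k : ℕ) (t : Fin k → I),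
        P.map (fun ω i => X (t i) ω) = P'.map (fun ω' i => Y (t i) ω') := by
  obtain ⟨Y, hYm, hYc, hXY⟩ := exists_cadlag_modification hX hα hβ hFmono hFcont ha hc
  -- `Ω'` must lie in `Type` whatever the universe of `Ω`; the law of the modification on path
  -- space, with the coordinate process, achieves this.
  let T : Ω → CadlagPath := fun ω => ⟨fun t => Y t ω, hYc ω⟩
  have hT : Measurable T := (measurable_pi_lambda _ hYm).subtype_mk
  refine ⟨CadlagPath, inferInstance, P.map T, Measure.isProbabilityMeasure_map hT.aemeasurable,
    fun t y => y.1 t, fun t => (measurable_pi_apply t).comp measurable_subtype_coe,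
    fun y => y.2, fun k t => ?_⟩
  have hev : Measurable fun (y : CadlagPath) (i : Fin k) => y.1 (t i) :=
    measurable_pi_lambda _ fun i => (measurable_pi_apply (t i)).comp measurable_subtype_coe
  refine Eq.trans ?_ (Measure.map_map hev hT).symm
  exact map_eq_map_of_ae_inseparable (fun i => hX (t i)) (fun i => hYm (t i)) fun i => hXY (t i)
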